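/- Let \[ C_0=\Big\{\sum_{n=2}^{\infty}\frac{d_n}{n!} \;:\; d_n\in\{0,1,\dots,n-2\}\text{ for all } n\ge 2\Big\}\subset\mathbb R . \] A perfect cube is a product $\prod_{n\in\omega}D_n\subseteq(2^\omega)^\omega$ of nonempty perfect sets $D_n\subseteq 2^\omega$. For a Polish space $X$ let $\mathrm{Perf}(X)$ be the family of all subsets of $X$ homeomorphic to the Cantor set $2^\omega$; a family $\mathcal E\subseteq \mathrm{Perf}(X)$ is cube-dense if for every continuous injection $f\colon C\to X$ defined on a perfect cube $C$ there is a perfect cube $C'\subseteq C$ with $f[C']\in\mathcal E$. The Covering Property Axiom (CPA) of Ciesielski and Pawlikowski, in its basic and weakest form $\mathrm{CPA}_{\mathrm{cube}}$, says that $2^\omega=\omega_2$ and that for every Polish space $X$ and every cube-dense family $\mathcal E\subseteq\mathrm{Perf}(X)$ there is $\mathcal E_0\subseteq\mathcal E$ with $|\mathcal E_0|\le\omega_1$ and $|X\setminus\bigcup\mathcal E_0|\le\omega_1$. Theorem. $C_0$ is a compact set of Lebesgue measure zero, and $\mathrm{CPA}_{\mathrm{cube}}$ implies that $\mathbb R$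 can be covered by fewer than $2^{\omega}$ many translates of $C_0$: there is $T\subset\mathbb R$ with $|T|<2^\omega$ and $\bigcup_{t\in T}(C_0+t)=\mathbb R$. -/

import Mathlib

open Set Cardinal MeasureTheory
open scoped Nat

/-- The set `C₀` of all sums `∑_{n ≥ 2} d_n / n!` with digits `d_n ∈ {0, 1, …, n - 2}`.
The condition `d n + 2 ≤ n` is `d n ≤ n - 2` without truncated subtraction, and the series
is indexed by `k = n - 2`. -/
def C₀ : Set ℝ :=
  {x | ∃ d : ℕ → ℕ, (∀ n, 2 ≤ n → d n + 2 ≤ n) ∧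
    HasSum (fun k : ℕ => (d (k + 2) : ℝ) / ((k + 2)! : ℝ)) x}

namespace CiesielskiPawlikowski

/-- The Cantor space `2^ω`. -/
abbrev Cantor : Type := ℕ → Bool

/-- `Perf(X)`: the family of all subsets of `X` that are homeomorphic to the Cantor space. -/
def Perf (X : Type*) [TopologicalSpace X] : Set (Set X) :=
  {Q | Nonempty (Q ≃ₜ Cantor)}

/-- A perfect cube: a product `∏ n, D n ⊆ (2^ω)^ω` of nonempty perfect sets `D n ⊆ 2^ω`. -/
def IsPerfectCube (C : Set (ℕ → Cantor)) : Prop :=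
  ∃ D : ℕ → Set Cantor, (∀ n, Perfect (D n) ∧ (D n).Nonempty) ∧ C = Set.univ.pi D

/-- A family `E` of subsets of `X` is cube-dense if for every continuous injection `f` from a
perfect cube `C` to `X` there is a perfect cube `C' ⊆ C` with `f[C'] ∈ E`. (Only the values
of `f` on `C` matter.) -/
def CubeDense {X : Type*} [TopologicalSpace X] (E : Set (Set X)) : Prop :=
  ∀ (C : Set (ℕ → Cantor)) (f : (ℕ → Cantor) → X),
    IsPerfectCube C → ContinuousOn f C → InjOn f C →
      ∃ C' : Set (ℕ → Cantor), IsPerfectCube C' ∧ C' ⊆ C ∧ f '' C' ∈ E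

/-- The Covering Property Axiom (CPA) of Ciesielski and Pawlikowski, in its basic (weakest) form
`CPA_cube`: `𝔠 = ω₂`, and for every Polish space `X` and every cube-dense family
`E ⊆ Perf(X)` there is `E₀ ⊆ E` with `|E₀| ≤ ω₁` and `|X \ ⋃ E₀| ≤ ω₁`.
Since Polish spaces have at most continuum many points, all of them occur, up to
homeomorphism, in `Type`. -/
def CPAcube : Prop :=
  𝔠 = (ℵ_ 2 : Cardinal.{0}) ∧
  ∀ (X : Type) [TopologicalSpace X] [PolishSpace X] (E : Set (Set X)),
    E ⊆ Perf X → CubeDense E →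
      ∃ E₀ : Set (Set X), E₀ ⊆ E ∧ #E₀ ≤ ℵ_ 1 ∧ #((⋃₀ E₀)ᶜ : Set X) ≤ ℵ_ 1

end CiesielskiPawlikowski

/-!
`C₀` is the image of a compact product of finite digit sets under a uniformly convergent series.
Its tails satisfy `volume (digitTail m) ≤ m * volume (digitTail (m + 1))`, and `digitTail m` lies
in `[0, 1 / m!]`, so `volume C₀ ≤ m! / (m + 1)!` for all `m`.

For the covering, call `K ⊆ ℝ` thin if for every `n ≥ 5` fewer than `n / 4` intervals of radius
`1 / n!` cover `K`. A thin set lies in a translate `C₀ + t` (`exists_translate`): a number of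
`[0, 1)` is in `C₀` as soon as no factorial digit `⌊n! y⌋ mod n` is `n - 1`, and when `t` is chosen
digit by digit, each interval covering `K` rules out at most four values of the `n`-th digit of `t`,
so an admissible value remains.

Moreover, any continuous injection `f` on a perfect cube has a thin image on some subcube: after
parametrizing each factor by the Cantor space, `f` depends up to `1 / n!` on finitely many levels
of digits only, and the subcube keeps digits free only at positions so sparse that at most
`log₂ n - 3` free digits are among those levels (`exists_spread`). Hence the copies of the
Cantor set contained in translates of `C₀` form a cube-dense family (`cubeDense_translates`), and
`CPA_cube` covers `ℝ`, up to `ω₁` points, by `ω₁ < ω₂ = 𝔠` members of it. Each remaining point is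
covered by one more translate.
-/

/-! ### The set `C₀` is compact and null -/

/-- The sums `∑_{n > m} d_n / n!` with `0 ≤ d_n ≤ n - 2`, the series being indexed by
`k = n - m - 1`. -/
def digitTail (m : ℕ) : Set ℝ :=
  {x | ∃ d : ℕ → ℕ, (∀ k, d k + 1 ≤ k + m) ∧
    HasSum (fun k : ℕ => (d k : ℝ) / ((k + m + 1)! : ℝ)) x}

lemma C₀_eq_digitTail : C₀ = digitTail 1 := by
  ext x
  constructor
  · rintro ⟨d, hd, hx⟩
    exact ⟨fun k => d (k + 2), fun k => by have := hd (k + 2) (by omega); dsimp only; omega, hx⟩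
  · rintro ⟨d, hd, hx⟩
    refine ⟨fun n => d (n - 2), fun n hn => by have := hd (n - 2); dsimp only; omega, ?_⟩
    simpa using hx

lemma one_div_factorial_sub (k : ℕ) :
    (1 : ℝ) / (k ! : ℝ) - 1 / ((k + 1)! : ℝ) = k / ((k + 1)! : ℝ) := by
  rw [Nat.factorial_succ]
  push_cast
  have : (k ! : ℝ) ≠ 0 := by positivity
  field_simp
  ring

lemma hasSum_digitTail_bound (m : ℕ) :
    HasSum (fun k : ℕ => ((k + m : ℕ) : ℝ) / ((k + m + 1)! : ℝ)) (1 / (m ! : ℝ)) := by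
  rw [hasSum_iff_tendsto_nat_of_nonneg (fun k => by positivity)]
  have h : ∀ n, ∑ k ∈ Finset.range n, ((k + m : ℕ) : ℝ) / ((k + m + 1)! : ℝ)
      = 1 / (m ! : ℝ) - 1 / ((n + m)! : ℝ) := by
    intro n
    have := Finset.sum_range_sub' (fun k : ℕ => (1 : ℝ) / ((k + m)! : ℝ)) n
    simp only [zero_add] at this
    rw [← this]
    refine Finset.sum_congr rfl fun k _ => ?_
    rw [← one_div_factorial_sub, show k + 1 + m = k + m + 1 by ring]
  simp_rw [h]
  have h0 : Filter.Tendsto (fun n : ℕ => (1 : ℝ) / ((n + m)! : ℝ)) Filter.atTop (nhds 0) := by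
    have := (FloorSemiring.tendsto_pow_div_factorial_atTop (1 : ℝ)).comp
      (Filter.tendsto_add_atTop_nat m)
    simpa [Function.comp_def] using this
  simpa using tendsto_const_nhds.sub h0

lemma digitTail_subset_Icc (m : ℕ) : digitTail m ⊆ Icc 0 (1 / (m ! : ℝ)) := by
  rintro x ⟨d, hd, hx⟩
  refine ⟨hx.nonneg fun k => by positivity, hasSum_le (fun k => ?_) hx (hasSum_digitTail_bound m)⟩
  have : d k ≤ k + m := by have := hd k; omega
  gcongr

lemma digitTail_subset_iUnion (m : ℕ) :
    digitTail m ⊆ ⋃ c ∈ Finset.range m,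
      (fun x : ℝ => (c : ℝ) / ((m + 1)! : ℝ) + x) '' digitTail (m + 1) := by
  rintro x ⟨d, hd, hx⟩
  simp only [mem_iUnion, Finset.mem_range]
  refine ⟨d 0, by have := hd 0; omega, x - (d 0 : ℝ) / ((m + 1)! : ℝ), ?_, by ring⟩
  refine ⟨fun k => d (k + 1), fun k => by have := hd (k + 1); dsimp only; omega, ?_⟩
  have := (hasSum_nat_add_iff' 1).2 hx
  simpa [add_assoc, add_comm, add_left_comm] using this

lemma volume_digitTail_le (m : ℕ) :
    volume (digitTail m) ≤ m * volume (digitTail (m + 1)) := by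
  refine (measure_mono (digitTail_subset_iUnion m)).trans ?_
  refine (measure_biUnion_finset_le _ _).trans ?_
  simp

lemma volume_C₀_le (m : ℕ) : volume C₀ ≤ m ! * volume (digitTail (m + 1)) := by
  induction m with
  | zero => simp [C₀_eq_digitTail]
  | succ m ih =>
    refine ih.trans ?_
    rw [Nat.factorial_succ, mul_comm (m + 1) (m !)]
    push_cast
    rw [mul_assoc]
    gcongr
    exact_mod_cast volume_digitTail_le (m + 1)

lemma volume_C₀ : volume C₀ = 0 := by
  have h : ∀ m : ℕ, volume C₀ ≤ ENNReal.ofReal (1 / ((m : ℝ) + 1)) := by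
    intro m
    refine (volume_C₀_le m).trans ?_
    have h1 : volume (digitTail (m + 1)) ≤ ENNReal.ofReal (1 / ((m + 1)! : ℝ)) := by
      refine (measure_mono (digitTail_subset_Icc (m + 1))).trans ?_
      simp
    calc (m ! : ENNReal) * volume (digitTail (m + 1))
        ≤ (m ! : ENNReal) * ENNReal.ofReal (1 / ((m + 1)! : ℝ)) := by gcongr
      _ = ENNReal.ofReal ((m ! : ℝ) * (1 / ((m + 1)! : ℝ))) := by
        rw [ENNReal.ofReal_mul (by positivity), ENNReal.ofReal_natCast]
      _ = _ := by
        congr 1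
        rw [Nat.factorial_succ]
        push_cast
        have : (m ! : ℝ) ≠ 0 := by positivity
        field_simp
  have h0 : Filter.Tendsto (fun m : ℕ => ENNReal.ofReal (1 / ((m : ℝ) + 1)))
      Filter.atTop (nhds 0) := by
    simpa using ENNReal.tendsto_ofReal (tendsto_one_div_add_atTop_nhds_zero_nat (𝕜 := ℝ))
  exact le_antisymm (ge_of_tendsto' h0 h) zero_le

lemma isCompact_C₀ : IsCompact C₀ := by
  have hb : ∀ d ∈ univ.pi (fun k : ℕ => Iic k), ∀ k : ℕ,
      ‖(d k : ℝ) / ((k + 1 + 1)! : ℝ)‖ ≤ ((k + 1 : ℕ) : ℝ) / ((k + 1 + 1)! : ℝ) := by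
    intro d hd k
    rw [Real.norm_of_nonneg (by positivity)]
    have : d k ≤ k + 1 := (hd k (mem_univ k)).trans (Nat.le_succ k)
    gcongr
  have hc : IsCompact (univ.pi (fun k : ℕ => Iic k)) :=
    isCompact_univ_pi fun k => (finite_Iic k).isCompact
  have hf : ContinuousOn (fun d : ℕ → ℕ => ∑' k : ℕ, (d k : ℝ) / ((k + 1 + 1)! : ℝ))
      (univ.pi (fun k : ℕ => Iic k)) := by
    refine continuousOn_tsum (fun k => ?_) (hasSum_digitTail_bound 1).summable
      (fun k d hd => hb d hd k)
    exact ((continuous_of_discreteTopology (f := fun n : ℕ => (n : ℝ))).comp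
      (continuous_apply k)).continuousOn.div_const _
  convert hc.image_of_continuousOn hf using 1
  rw [C₀_eq_digitTail]
  ext x
  constructor
  · rintro ⟨d, hd, hx⟩
    exact ⟨d, fun k _ => Nat.le_of_succ_le_succ (hd k), hx.tsum_eq⟩
  · rintro ⟨d, hd, rfl⟩
    refine ⟨d, fun k => Nat.succ_le_succ (hd k (mem_univ k)), ?_⟩
    exact (Summable.of_norm_bounded (hasSum_digitTail_bound 1).summable (hb d hd)).hasSum

/-! ### Digit criterion for membership in `C₀` -/

/-- The digits of `y` in the factorial number system are `⌊n! y⌋ mod n`; if none of them takes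
its largest possible value `n - 1`, then `y` lies in `C₀`. -/
lemma mem_C₀_of_floor {y : ℝ} (hy0 : 0 ≤ y) (hy1 : y < 1)
    (hy : ∀ n : ℕ, 2 ≤ n → ⌊(n ! : ℝ) * y⌋₊ % n + 1 ≠ n) : y ∈ C₀ := by
  refine ⟨fun n => ⌊(n ! : ℝ) * y⌋₊ % n, fun n hn => ?_, ?_⟩
  · have := hy n hn
    have := Nat.mod_lt ⌊(n ! : ℝ) * y⌋₊ (show 0 < n by omega)
    dsimp only
    omega
  rw [hasSum_iff_tendsto_nat_of_nonneg (fun k => by positivity)]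
  have hs : ∀ m : ℕ, ∑ k ∈ Finset.range m,
      ((⌊((k + 2)! : ℝ) * y⌋₊ % (k + 2) : ℕ) : ℝ) / ((k + 2)! : ℝ)
        = (⌊((m + 1)! : ℝ) * y⌋₊ : ℝ) / ((m + 1)! : ℝ) := by
    intro m
    induction m with
    | zero => simp [Nat.floor_eq_zero.2 hy1]
    | succ m ih =>
      rw [Finset.sum_range_succ, ih]
      have hdiv : ⌊((m + 2)! : ℝ) * y⌋₊ / (m + 2) = ⌊((m + 1)! : ℝ) * y⌋₊ := by
        rw [← Nat.cast_mul_floor_div_cancel (n := m + 2) (by omega) (((m + 1)! : ℝ) * y),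
          Nat.factorial_succ (m + 1)]
        push_cast
        congr 2
        ring
      have hmod := Nat.div_add_mod ⌊((m + 2)! : ℝ) * y⌋₊ (m + 2)
      rw [hdiv] at hmod
      have hmodR : ((m + 2 : ℕ) : ℝ) * (⌊((m + 1)! : ℝ) * y⌋₊ : ℝ)
          + ((⌊((m + 2)! : ℝ) * y⌋₊ % (m + 2) : ℕ) : ℝ) = (⌊((m + 2)! : ℝ) * y⌋₊ : ℝ) := by
        exact_mod_cast hmod
      have hfac : ((m + 2)! : ℝ) = ((m + 2 : ℕ) : ℝ) * ((m + 1)! : ℝ) := by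
        rw [Nat.factorial_succ (m + 1)]
        push_cast
        ring
      rw [show m + 1 + 1 = m + 2 by ring, ← hmodR, hfac]
      have : ((m + 1)! : ℝ) ≠ 0 := by positivity
      have : ((m + 2 : ℕ) : ℝ) ≠ 0 := by positivity
      field_simp
  simp_rw [hs]
  have ht : Filter.Tendsto (fun m : ℕ => ((m + 1)! : ℝ)) Filter.atTop Filter.atTop := by
    refine tendsto_natCast_atTop_atTop.comp (Filter.tendsto_atTop_mono
      (fun m => (Nat.le_succ m).trans (Nat.self_le_factorial (m + 1))) Filter.tendsto_id)
  have := (tendsto_nat_floor_mul_div_atTop hy0).comp ht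
  refine this.congr fun m => ?_
  simp [mul_comm]

/-! ### Translating sets with few digits into `C₀` -/

/-- If `K` is covered by `m` intervals of radius `1 / n!` and `4 m < n`, some residue class `r`
of integers modulo `n` is such that translating by any `t ∈ [a / n!, (a + 1) / n!]` with
`a ≡ r` keeps the `n`-th factorial digit of every point of `K` away from `n - 1`: each
interval excludes at most four residues. -/
lemma exists_residue {K : Set ℝ} {n : ℕ} {B : Finset ℝ} (hB : 4 * B.card < n)
    (hK : ∀ x ∈ K, ∃ b ∈ B, |x - b| ≤ 1 / (n ! : ℝ)) :
    ∃ r : ℕ, r < n ∧ ∀ a : ℤ, a % n = r → ∀ t : ℝ, a ≤ n ! * t → n ! * t ≤ a + 1 →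
      ∀ x ∈ K, (⌊(n ! : ℝ) * (x - t)⌋ + 1) % (n : ℤ) ≠ 0 := by
  classical
  have hn : 0 < n := by omega
  let bad : Finset ℕ := (B ×ˢ Finset.range 4).image
    fun p => ((⌊(n ! : ℝ) * p.1⌋ + (p.2 : ℤ) - 1) % (n : ℤ)).toNat
  have hcard : bad.card < (Finset.range n).card := by
    refine Finset.card_image_le.trans_lt ?_
    rw [Finset.card_product, Finset.card_range, Finset.card_range]
    omega
  obtain ⟨r, hr, hrbad⟩ := Finset.exists_mem_notMem_of_card_lt_card hcard
  refine ⟨r, Finset.mem_range.1 hr, fun a ha t ht1 ht2 x hx h0 => hrbad ?_⟩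
  obtain ⟨b, hb, hxb⟩ := hK x hx
  have hpos : (0 : ℝ) < n ! := by positivity
  have hxb' : |(n ! : ℝ) * x - n ! * b| ≤ 1 := by
    rw [← mul_sub, abs_mul, abs_of_pos hpos]
    calc (n ! : ℝ) * |x - b| ≤ n ! * (1 / n !) := by gcongr
      _ = 1 := by field_simp
  obtain ⟨h1, h2⟩ := abs_le.1 hxb'
  have e1 := Int.floor_le ((n ! : ℝ) * (x - t))
  have e2 := Int.lt_floor_add_one ((n ! : ℝ) * (x - t))
  have f1 := Int.floor_le ((n ! : ℝ) * b)
  have f2 := Int.lt_floor_add_one ((n ! : ℝ) * b)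
  rw [mul_sub] at e1 e2 h0
  set v := ⌊(n ! : ℝ) * x - n ! * t⌋
  set u := ⌊(n ! : ℝ) * b⌋ with hu
  -- The relevant floor is `u - a + i` with `i ∈ {-2, -1, 0, 1}`.
  have g1 : u - a - 3 < v := by
    have : ((u - a - 3 : ℤ) : ℝ) < v := by push_cast; linarith
    exact_mod_cast this
  have g2 : v < u - a + 2 := by
    have : (v : ℝ) < ((u - a + 2 : ℤ) : ℝ) := by push_cast; linarith
    exact_mod_cast this
  refine Finset.mem_image.2 ⟨(b, (v - u + a + 2).toNat), ?_, ?_⟩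
  · simp only [Finset.mem_product, Finset.mem_range]
    exact ⟨hb, by omega⟩
  · have hcast : (((v - u + a + 2).toNat : ℕ) : ℤ) = v - u + a + 2 :=
      Int.toNat_of_nonneg (by omega)
    dsimp only
    rw [hcast, ← hu, show u + (v - u + a + 2) - 1 = (v + 1) + a by ring, Int.add_emod, h0,
      zero_add, Int.emod_emod, ha, Int.toNat_natCast]

/-- Prescribed residues `a n ≡ r n` modulo `n` are realised along a nested sequence of cells
`[a n / n!, (a n + 1) / n!]`, whose common point is `t`. -/
lemma exists_nested_cells (N : ℕ) (a₀ : ℤ) (r : ℕ → ℕ) (hr : ∀ n, N < n → r n < n) :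
    ∃ (a : ℕ → ℤ) (t : ℝ), a N = a₀ ∧ (∀ n, N < n → a n % n = r n) ∧
      ∀ n, N ≤ n → (a n : ℝ) ≤ n ! * t ∧ n ! * t ≤ a n + 1 := by
  obtain ⟨c, hc0, hc⟩ : ∃ c : ℕ → ℤ, c 0 = a₀ ∧
      ∀ k, c (k + 1) = ((N + k + 1 : ℕ) : ℤ) * c k + r (N + k + 1) :=
    ⟨Nat.rec a₀ fun j z => ((N + j + 1 : ℕ) : ℤ) * z + r (N + j + 1), rfl, fun _ => rfl⟩
  have hfac : ∀ k, ((N + (k + 1))! : ℝ) = ((N + k + 1 : ℕ) : ℝ) * ((N + k)! : ℝ) := by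
    intro k
    rw [← add_assoc, Nat.factorial_succ]
    push_cast
    ring
  have hanti : Antitone fun k : ℕ =>
      Icc ((c k : ℝ) / ((N + k)! : ℝ)) (((c k : ℝ) + 1) / ((N + k)! : ℝ)) := by
    refine antitone_nat_of_succ_le fun k => ?_
    have hp : (0 : ℝ) < (N + k)! := by positivity
    have hq : (0 : ℝ) < ((N + k + 1 : ℕ) : ℝ) := by positivity
    have hrk : (r (N + k + 1) : ℝ) + 1 ≤ ((N + k + 1 : ℕ) : ℝ) := by
      exact_mod_cast hr (N + k + 1) (by omega)
    refine Icc_subset_Icc ?_ ?_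
    · rw [hfac, hc, div_le_div_iff₀ hp (by positivity)]
      push_cast
      have : (0 : ℝ) ≤ r (N + k + 1) * (N + k)! := by positivity
      nlinarith
    · rw [hfac, hc, div_le_div_iff₀ (by positivity) hp]
      have := mul_le_mul_of_nonneg_right hrk hp.le
      push_cast at this ⊢
      nlinarith
  have hmem := ciSup_mem_iInter_Icc_of_antitone_Icc hanti fun k => by gcongr; linarith
  set t := ⨆ k : ℕ, (c k : ℝ) / ((N + k)! : ℝ)
  refine ⟨fun n => c (n - N), t, by simp [hc0], fun n hn => ?_, fun n hn => ?_⟩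
  · obtain ⟨k, rfl⟩ := Nat.exists_eq_add_of_lt hn
    have := hr (N + k + 1) hn
    simp only [show N + k + 1 - N = k + 1 by omega, hc]
    rw [Int.mul_add_emod_self_left]
    exact Int.emod_eq_of_lt (by positivity) (by exact_mod_cast this)
  · obtain ⟨k, rfl⟩ := Nat.exists_eq_add_of_le hn
    have hk := mem_iInter.1 hmem k
    have hp : (0 : ℝ) < (N + k)! := by positivity
    rw [mem_Icc, div_le_iff₀ hp, le_div_iff₀ hp] at hk
    simp only [Nat.add_sub_cancel_left]
    constructor <;> linarith [hk.1, hk.2]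

/-- A set which for every `n ≥ 5` is covered by fewer than `n / 4` intervals of radius `1 / n!`
is contained in a translate of `C₀`. -/
lemma exists_translate {K : Set ℝ}
    (hK : ∀ n : ℕ, 5 ≤ n → ∃ B : Finset ℝ, 4 * B.card < n ∧
      ∀ x ∈ K, ∃ b ∈ B, |x - b| ≤ 1 / (n ! : ℝ)) :
    ∃ t : ℝ, K ⊆ (fun c : ℝ => c + t) '' C₀ := by
  -- At `n = 5` there is at most one interval; `b` is its centre.
  obtain ⟨b, hb⟩ : ∃ b : ℝ, ∀ x ∈ K, |x - b| ≤ 1 / (5 ! : ℝ) := by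
    obtain ⟨B, hB, h⟩ := hK 5 le_rfl
    rcases K.eq_empty_or_nonempty with rfl | ⟨x₀, hx₀⟩
    · exact ⟨0, by simp⟩
    obtain ⟨b, hbB, -⟩ := h x₀ hx₀
    refine ⟨b, fun x hx => ?_⟩
    obtain ⟨b', hb'B, hb'⟩ := h x hx
    rwa [Finset.card_le_one.1 (by omega) b hbB b' hb'B]
  have hres : ∀ n : ℕ, ∃ r : ℕ, 5 < n → r < n ∧ ∀ a : ℤ, a % n = r →
      ∀ t : ℝ, a ≤ n ! * t → n ! * t ≤ a + 1 →
      ∀ x ∈ K, (⌊(n ! : ℝ) * (x - t)⌋ + 1) % (n : ℤ) ≠ 0 := by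
    intro n
    by_cases hn : 5 < n
    · obtain ⟨B, hB, h⟩ := hK n hn.le
      obtain ⟨r, hr⟩ := exists_residue hB h
      exact ⟨r, fun _ => hr⟩
    · exact ⟨0, fun h => absurd h hn⟩
  choose r hr using hres
  -- With this starting cell, `5! (x - t)` lies in `[0, 4)` for all `x ∈ K`.
  obtain ⟨a, t, ha5, ha, hat⟩ := exists_nested_cells 5 (⌊(5 ! : ℝ) * b⌋ - 2) r
    fun n hn => (hr n hn).1
  refine ⟨t, fun x hx => ⟨x - t, ?_, by simp⟩⟩
  have h5 := hat 5 le_rfl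
  have hxb := abs_le.1 (hb x hx)
  have f1 := Int.floor_le ((5 ! : ℝ) * b)
  have f2 := Int.lt_floor_add_one ((5 ! : ℝ) * b)
  rw [ha5] at h5
  push_cast at h5
  have h120 : (5 ! : ℝ) = 120 := by norm_num [Nat.factorial]
  rw [h120] at hxb f1 f2 h5
  have y0 : 0 ≤ x - t := by linarith [h5.1, h5.2, hxb.1, hxb.2]
  have y1 : 120 * (x - t) < 4 := by linarith [h5.1, h5.2, hxb.1, hxb.2]
  refine mem_C₀_of_floor y0 (by linarith) fun n hn => ?_
  rcases lt_trichotomy n 5 with h | rfl | h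
  · have hlt : (n ! : ℝ) * (x - t) < 1 := by
      have : (n ! : ℝ) ≤ (4 ! : ℝ) := by exact_mod_cast Nat.factorial_le (by omega)
      have h24 : (4 ! : ℝ) = 24 := by norm_num [Nat.factorial]
      nlinarith
    rw [Nat.floor_eq_zero.2 hlt]
    simp only [Nat.zero_mod]
    omega
  · have : ⌊(5 ! : ℝ) * (x - t)⌋₊ < 4 := by
      rw [Nat.floor_lt (by positivity), h120]
      push_cast
      exact y1
    omega
  · have key := (hr n h).2 (a n) (ha n h) t (hat n h.le).1 (hat n h.le).2 x hx
    rw [← Int.natCast_floor_eq_floor (by positivity)] at key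
    intro h'
    apply key
    have : (n : ℕ) ∣ ⌊(n ! : ℝ) * (x - t)⌋₊ + 1 := by
      have hmod := Nat.div_add_mod ⌊(n ! : ℝ) * (x - t)⌋₊ n
      refine ⟨⌊(n ! : ℝ) * (x - t)⌋₊ / n + 1, ?_⟩
      rw [mul_add, mul_one]
      omega
    exact Int.emod_eq_zero_of_dvd (by exact_mod_cast this)

/-! ### Sparse subcubes -/

open CiesielskiPawlikowski

lemma perfectSpace_cantor : PerfectSpace Cantor := by
  refine ⟨preperfect_iff_nhds.2 fun x _ U hU => ?_⟩
  -- Changing a far-out coordinate of `x` gives a different point close to `x`.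
  have ht : Filter.Tendsto (fun n : ℕ => Function.update x n (!x n)) Filter.atTop (nhds x) := by
    rw [tendsto_pi_nhds]
    intro i
    refine tendsto_const_nhds.congr' ?_
    filter_upwards [Filter.eventually_gt_atTop i] with n hn
    rw [Function.update_of_ne hn.ne]
  obtain ⟨n, hn⟩ := (ht.eventually hU).exists
  refine ⟨_, ⟨hn, mem_univ _⟩, fun h => ?_⟩
  simpa using congrFun h n

lemma perfect_range_cantor {g : Cantor → Cantor} (hg : Continuous g)
    (hinj : Function.Injective g) : Perfect (range g) := by
  refine ⟨(isCompact_range hg).isClosed, ?_⟩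
  rintro _ ⟨x, rfl⟩
  have := perfectSpace_cantor
  have := (PerfectSpace.univ_preperfect x (mem_univ x)).map hg.continuousAt hinj
  rwa [Filter.map_principal, image_univ] at this

/-- A product of ranges of continuous injections is a perfect cube. -/
lemma isPerfectCube_range {g : ℕ → Cantor → Cantor} (hg : ∀ i, Continuous (g i))
    (hinj : ∀ i, Function.Injective (g i)) :
    IsPerfectCube (range fun (z : ℕ → Cantor) (i : ℕ) => g i (z i)) := by
  refine ⟨fun i => range (g i), fun i => ⟨perfect_range_cantor (hg i) (hinj i),
    range_nonempty _⟩, ?_⟩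
  ext w
  simp only [mem_range, mem_univ_pi]
  constructor
  · rintro ⟨z, rfl⟩ i
    exact ⟨z i, rfl⟩
  · intro h
    choose z hz using h
    exact ⟨z, funext hz⟩

lemma range_mem_Perf {X : Type*} [TopologicalSpace X] [T2Space X] {G : (ℕ → Cantor) → X}
    (hG : Continuous G) (hinj : Function.Injective G) : range G ∈ Perf X :=
  ⟨(hG.isClosedEmbedding hinj).toHomeomorph.symm.trans
    cantorSpaceHomeomorphNatToCantorSpace.symm⟩

/-- Uniform continuity on `(2^ω)^ω` in combinatorial form. -/
lemma exists_modulus {F : (ℕ → Cantor) → ℝ} (hF : Continuous F) {ε : ℝ} (hε : 0 < ε) :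
    ∃ L : ℕ, ∀ x y : ℕ → Cantor, (∀ i m, m < L → x i m = y i m) → |F x - F y| < ε := by
  let V : ℕ → Set ((ℕ → Cantor) × (ℕ → Cantor)) :=
    fun L => {p | ∀ i m, m < L → p.1 i m = p.2 i m}
  have hV : Antitone V := fun L L' h p hp i m hm => hp i m (hm.trans_le h)
  have hcl : ∀ L, IsClosed (V L) := by
    intro L
    simp only [V, ofPred_forall]
    refine isClosed_iInter fun i => isClosed_iInter fun m => isClosed_iInter fun _ => ?_
    exact isClosed_eq (by fun_prop) (by fun_prop)
  have hopen : IsOpen {p : (ℕ → Cantor) × (ℕ → Cantor) | |F p.1 - F p.2| < ε} :=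
    isOpen_lt (by fun_prop) continuous_const
  obtain ⟨L, hL⟩ := exists_subset_nhds_of_compactSpace (V := V) (directed_of_isDirected_le hV) hcl
    (U := {p | |F p.1 - F p.2| < ε}) (by
      intro p hp
      refine hopen.mem_nhds ?_
      have : p.1 = p.2 := by
        funext i m
        exact mem_iInter.1 hp (m + 1) i m (Nat.lt_succ_self m)
      simpa [this] using hε)
  exact ⟨L, fun x y h => hL (a := (x, y)) h⟩

/-- Spread the digits of `z` along the positions `s 0, s 1, …` and put `false` elsewhere. -/
noncomputable def spread (s : ℕ → ℕ) (z : Cantor) : Cantor :=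
  Function.extend s z fun _ => false

lemma continuous_spread {s : ℕ → ℕ} (hs : Function.Injective s) : Continuous (spread s) := by
  refine continuous_pi fun m => ?_
  by_cases hm : ∃ a, s a = m
  · obtain ⟨a, rfl⟩ := hm
    simpa only [spread, hs.extend_apply] using continuous_apply a
  · simpa only [spread, Function.extend_apply' _ _ _ hm] using continuous_const

lemma spread_injective {s : ℕ → ℕ} (hs : Function.Injective s) :
    Function.Injective (spread s) := by
  intro z z' h
  funext a
  simpa only [spread, hs.extend_apply] using congrFun h (s a)

/-- Every continuous function on `(2^ω)^ω` can be restricted to a subcube with such sparse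
digits that its values fit, for each `n ≥ 5`, into fewer than `n / 4` intervals of radius
`1 / n!`. The digit at place `a` of the `i`-th factor is moved to `s i a`, which lies beyond
all digits relevant to the precision `1 / n!` unless `2 ^ (Nat.pair i a + 4) < n`. -/
lemma exists_spread {F : (ℕ → Cantor) → ℝ} (hF : Continuous F) :
    ∃ s : ℕ → ℕ → ℕ, (∀ i, Function.Injective (s i)) ∧ ∀ n : ℕ, 5 ≤ n →
      ∃ B : Finset ℝ, 4 * B.card < n ∧ ∀ x ∈ range fun z : ℕ → Cantor =>
        F fun i => spread (s i) (z i), ∃ b ∈ B, |x - b| ≤ 1 / (n ! : ℝ) := by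
  classical
  obtain ⟨L, hLmono, hL⟩ : ∃ L : ℕ → ℕ, Monotone L ∧ ∀ n, ∀ x y : ℕ → Cantor,
      (∀ i m, m < L n → x i m = y i m) → |F x - F y| < 1 / (n ! : ℝ) := by
    choose L₀ hL₀ using fun n : ℕ => exists_modulus hF (show (0 : ℝ) < 1 / (n ! : ℝ) by positivity)
    refine ⟨fun n => ∑ k ∈ Finset.range (n + 1), L₀ k, fun a b h => ?_, fun n x y h => ?_⟩
    · exact Finset.sum_le_sum_of_subset (Finset.range_mono (by omega))
    · refine hL₀ n x y fun i m hm => h i m (hm.trans_le ?_)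
      exact Finset.single_le_sum (f := L₀) (fun _ _ => Nat.zero_le _) (Finset.self_mem_range_succ n)
  let σ : ℕ → ℕ := fun j => L (2 ^ (j + 4)) + j
  have hσ : StrictMono σ := fun j k h => by
    have := hLmono (Nat.pow_le_pow_right (show 0 < 2 by norm_num) (show j + 4 ≤ k + 4 by omega))
    simp only [σ]
    omega
  let s : ℕ → ℕ → ℕ := fun i a => σ (Nat.pair i a)
  have hs : ∀ i, Function.Injective (s i) := fun i a b h =>
    (Nat.pair_eq_pair.1 (hσ.injective h)).2
  refine ⟨s, hs, fun n hn => ?_⟩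
  set J := Nat.log 2 n - 3 with hJ
  -- Only the digits with `Nat.pair i a < J` matter up to `1 / n!`; in `zp p` a digit is `true`
  -- exactly when its code lies in `p`.
  let zp : Finset ℕ → ℕ → Cantor := fun p i a => decide (Nat.pair i a ∈ p)
  refine ⟨(Finset.range J).powerset.image fun p => F fun i => spread (s i) (zp p i), ?_, ?_⟩
  · have hc := Finset.card_image_le (s := (Finset.range J).powerset)
      (f := fun p => F fun i => spread (s i) (zp p i))
    rw [Finset.card_powerset, Finset.card_range] at hc
    have hlog : 2 ^ Nat.log 2 n ≤ n := Nat.pow_log_le_self 2 (by omega)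
    rcases Nat.eq_zero_or_pos J with h | h
    · have : 2 ^ J = 1 := by rw [h, pow_zero]
      omega
    · rw [show Nat.log 2 n = J + 3 by omega, pow_add] at hlog
      omega
  · rintro _ ⟨z, rfl⟩
    let p := (Finset.range J).filter fun j => z (Nat.unpair j).1 (Nat.unpair j).2 = true
    refine ⟨_, Finset.mem_image_of_mem _ (Finset.mem_powerset.2 (Finset.filter_subset _ _ :
      p ⊆ _)), (hL n _ _ fun i m hm => ?_).le⟩
    by_cases h : ∃ a, s i a = m
    · obtain ⟨a, rfl⟩ := h
      simp only [spread, (hs i).extend_apply]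
      have hlt : 2 ^ (Nat.pair i a + 4) < n := by
        by_contra hge
        have := hLmono (not_lt.1 hge)
        simp only [s, σ] at hm
        omega
      have hlt' : Nat.pair i a < J := by
        have := Nat.le_log_of_pow_le (by norm_num) hlt.le
        omega
      simp [zp, hlt']
    · simp only [spread, Function.extend_apply' _ _ _ h]

/-! ### The cube-dense family -/

/-- The copies of the Cantor set contained in a translate of `C₀` are cube-dense. -/
lemma cubeDense_translates :
    CubeDense {Q : Set ℝ | Q ∈ Perf ℝ ∧ ∃ t : ℝ, Q ⊆ (fun c : ℝ => c + t) '' C₀} := by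
  rintro C f ⟨D, hD, rfl⟩ hf hinj
  let := TopologicalSpace.upgradeIsCompletelyMetrizable Cantor
  choose e he using fun i => (hD i).1.exists_nat_bool_injection (hD i).2
  have hmem : ∀ z : ℕ → Cantor, (fun i => e i (z i)) ∈ univ.pi D := fun z i _ =>
    (he i).1 (mem_range_self _)
  have hec : ∀ i, Continuous (e i) := fun i => (he i).2.1
  have hF : Continuous fun z : ℕ → Cantor => f fun i => e i (z i) :=
    hf.comp_continuous (by fun_prop) hmem
  obtain ⟨s, hs, hB⟩ := exists_spread hF
  have hgc : ∀ i, Continuous fun w : Cantor => e i (spread (s i) w) := fun i =>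
    (hec i).comp (continuous_spread (hs i))
  have hgi : ∀ i, Function.Injective fun w : Cantor => e i (spread (s i) w) := fun i =>
    (he i).2.2.comp (spread_injective (hs i))
  refine ⟨range fun (z : ℕ → Cantor) (i : ℕ) => e i (spread (s i) (z i)),
    isPerfectCube_range hgc hgi, ?_, ?_, ?_⟩
  · rintro _ ⟨z, rfl⟩
    exact hmem _
  · rw [← range_comp]
    refine range_mem_Perf (hf.comp_continuous ?_ fun z => hmem _) fun z z' h => ?_
    · exact continuous_pi fun i => (hgc i).comp (continuous_apply i)
    · have := hinj (hmem _) (hmem _) h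
      exact funext fun i => hgi i (congrFun this i)
  · rw [← range_comp]
    exact exists_translate hB

lemma zero_mem_C₀ : (0 : ℝ) ∈ C₀ :=
  ⟨fun _ => 0, fun n hn => by omega, by simp⟩

theorem theorem2 :
    IsCompact C₀ ∧ volume C₀ = 0 ∧
    (CiesielskiPawlikowski.CPAcube →
      ∃ T : Set ℝ, #T < 𝔠 ∧ (⋃ t ∈ T, (fun c : ℝ => c + t) '' C₀) = Set.univ) := by
  refine ⟨isCompact_C₀, volume_C₀, ?_⟩
  rintro ⟨hc, hcpa⟩
  obtain ⟨E₀, hE₀, hcard, hrest⟩ := hcpa ℝ _ (fun Q hQ => hQ.1) cubeDense_translates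
  choose τ hτ using fun Q : E₀ => (hE₀ Q.2).2
  refine ⟨range τ ∪ (⋃₀ E₀)ᶜ, ?_, ?_⟩
  · have h1 : #(range τ ∪ (⋃₀ E₀)ᶜ : Set ℝ) ≤ ℵ_ 1 :=
      (mk_union_le _ _).trans (add_le_of_le (aleph0_le_aleph 1) (mk_range_le.trans hcard) hrest)
    rw [hc]
    exact h1.trans_lt (aleph_lt_aleph.2 (by norm_num))
  · refine eq_univ_of_forall fun x => ?_
    simp only [mem_iUnion]
    by_cases hx : x ∈ ⋃₀ E₀
    · obtain ⟨Q, hQ, hxQ⟩ := hx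
      exact ⟨τ ⟨Q, hQ⟩, Or.inl (mem_range_self _), hτ ⟨Q, hQ⟩ hxQ⟩
    · exact ⟨x, Or.inr hx, 0, zero_mem_C₀, zero_add x⟩
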